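/- Let $\mathcal N\ge 2$ and $\alpha,\beta\in\{0,1,\dots,\mathcal N-1\}$ be integers, let $p_1,p_2\in\mathbb C\setminus\{0\}$, let $\omega$ be a primitive $\mathcal N$th root of unity (for instance $\omega=e^{2\pi \mathrm i/\mathcal N}$), and let $J=\{j\in\mathbb Z : 0<j<\mathcal N,\ \gcd(j,\mathcal N)=1\}$. For $n,m,r\in\mathbb Z$ put $$\rho_{n,m}^{(r)}(k)=(k^\alpha(p_1+k))^{n}(k^\beta(p_2+k))^{m}k^r,\qquad \sigma_{n,m}^{(r)}(k')=(k'^\alpha(p_1+k'))^{-n}(k'^\beta(p_2+k'))^{-m}k'^{-r}.$$ For every $j\in J$ let $\Gamma_j\subset\mathbb C$ be a contour (any Borel set) with a complex-valued measure $\mathrm d\lambda_j$ on it, given by a Borel measurable complex density with respect to an arbitrary positive Borel measure, and let $K\subset\mathbb C$ be a set of spectral parameters containing all the $\Gamma_j$, such that $k\ne0$, $p_1+k\neq 0$, $p_2+k\ne0$ for $k\in K$; $p_1+\omega^jl\ne0$, $p_2+\omega^jl\neq 0$ for $j\in J$, $l\in\Gamma_j$; and, for every $k\in K$ and $j\in J$,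 $k\ne\omega^jl$ for almost every $l\in\Gamma_j$ (with respect to the positive measure underlying $\mathrm d\lambda_j$). Consider, for each $(n,m,r)\in\mathbb Z^3$, the linear integral equation $$\phi_{n,m}^{(r)}(k)+\sum_{j\in J}\int_{\Gamma_j}\mathrm d\lambda_j(l)\,\frac{\rho_{n,m}^{(r)}(k)\,\sigma_{n,m}^{(r)}(\omega^jl)}{k-\omega^jl}\,\phi_{n,m}^{(r)}(l)=\rho_{n,m}^{(r)}(k),\qquad k\in K,$$ where a solution is a function for which all these integrals converge absolutely. Assume that for each $(n,m,r)$ this equation has at most one solution on $K$. Let $\phi=(\phi_{n,m}^{(r)})_{n,m,r\in\mathbb Z}$ be any family of solutions for which the integrals in $$u_{n,m}^{(r)}=\sum_{j\in J}\int_{\Gamma_j}\mathrm d\lambda_j(k)\,\phi_{n,m}^{(r)}(k)\,\sigma_{n,m}^{(r)}(\omega^jk),\qquad v_{n,m}^{(r)}=1+\sum_{j\in J}\int_{\Gamma_j}\mathrm d\lambda_j(k)\,\phi_{n,m}^{(r)}(k)\,\sigma_{n,m}^{(r)}(\omega^jk)\,\omega^{-j}k^{-1}$$ converge absolutely. Then,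 for all $n,m,r\in\mathbb Z$: (1) $u_{n,m}^{(r+\mathcal N)}=u_{n,m}^{(r)}$ and $$\frac{p_1+u_{n,m+1}^{(r+1+\alpha)}-u_{n+1,m+1}^{(r)}}{p_1+u_{n,m}^{(r+1+\alpha+\beta)}-u_{n+1,m}^{(r+\beta)}}=\frac{p_2+u_{n+1,m}^{(r+1+\beta)}-u_{n+1,m+1}^{(r)}}{p_2+u_{n,m}^{(r+1+\alpha+\beta)}-u_{n,m+1}^{(r+\alpha)}},$$ where the denominators do not vanish; (2) $v_{n,m}^{(r+\mathcal N)}=v_{n,m}^{(r)}$, $v_{n,m}^{(r)}\ne0$, and $$p_1\left(\frac{v_{n+1,m+1}^{(r)}}{v_{n,m+1}^{(r+\alpha)}}-\frac{v_{n+1,m}^{(r+1+\beta)}}{v_{n,m}^{(r+1+\alpha+\beta)}}\right)=p_2\left(\frac{v_{n+1,m+1}^{(r)}}{v_{n+1,m}^{(r+\beta)}}-\frac{v_{n,m+1}^{(r+1+\alpha)}}{v_{n,m}^{(r+1+\alpha+\beta)}}\right);$$ (3) $\phi$ solves the $\mathbb Z_{\mathcal N}$-graded Lax pair: for every $k\in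 K$, $$\phi_{n+1,m}^{(r)}=\left(p_1+u_{n,m}^{(r+1+\alpha)}-u_{n+1,m}^{(r)}\right)\phi_{n,m}^{(r+\alpha)}+\phi_{n,m}^{(r+1+\alpha)},\qquad \phi_{n,m+1}^{(r)}=\left(p_2+u_{n,m}^{(r+1+\beta)}-u_{n,m+1}^{(r)}\right)\phi_{n,m}^{(r+\beta)}+\phi_{n,m}^{(r+1+\beta)},$$ with the closure condition $\phi_{n,m}^{(r+\mathcal N)}(k)=k^{\mathcal N}\phi_{n,m}^{(r)}(k)$. -/

import Mathlib

namespace FordyXenitidis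

open MeasureTheory

/-- A contour `Γ` in the complex spectral plane together with a complex-valued measure `dλ` on it.
The complex measure is written in polar form `dλ(l) = density l · dbase(l)` with a positive Borel
measure `base`; no finiteness is imposed, so that unbounded contours, line integrals
`f(γ(t)) γ'(t) dt` and finite sums of point masses are all included. -/
structure SpectralMeasure where
  contour : Set ℂ
  measurableSet_contour : MeasurableSet contour
  base : Measure ℂ
  density : ℂ → ℂ
  measurable_density : Measurable density

namespace SpectralMeasure

/-- The integral of `f` against `dλ` converges absolutely. -/
def Converges (lam : SpectralMeasure) (f : ℂ → ℂ) : Prop :=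
  IntegrableOn (fun l => f l * lam.density l) lam.contour lam.base

/-- `∫_Γ dλ(l) f(l)`. -/
noncomputable def integral (lam : SpectralMeasure) (f : ℂ → ℂ) : ℂ :=
  ∫ l in lam.contour, f l * lam.density l ∂lam.base

end SpectralMeasure

/-- The index set of the integers `0 < j < N` that are coprime to `N`. -/
def J (N : ℕ) : Finset ℕ :=
  (Finset.range N).filter fun j => 0 < j ∧ Nat.Coprime j N

/-- The plane wave factor `ρ`. -/
noncomputable def rho (α β : ℕ) (p₁ p₂ : ℂ) (n m r : ℤ) (k : ℂ) : ℂ :=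
  (k ^ α * (p₁ + k)) ^ n * (k ^ β * (p₂ + k)) ^ m * k ^ r

/-- The plane wave factor `σ`. -/
noncomputable def sigma (α β : ℕ) (p₁ p₂ : ℂ) (n m r : ℤ) (k : ℂ) : ℂ :=
  (k ^ α * (p₁ + k)) ^ (-n) * (k ^ β * (p₂ + k)) ^ (-m) * k ^ (-r)

/-- Everything in the integral equation is well defined on the spectral domain `K`: it contains the
contours, the plane wave factors have no zeros or poles where they are evaluated, and the
kernel `1 / (k - ω ^ j l)` is defined for almost every `l` on the contour. -/
structure Nondegenerate (N : ℕ) (ω p₁ p₂ : ℂ) (lam : ℕ → SpectralMeasure) (K : Set ℂ) :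
    Prop where
  contour_subset : ∀ j ∈ J N, (lam j).contour ⊆ K
  ne_zero : ∀ k ∈ K, k ≠ 0
  p₁_add_ne_zero : ∀ k ∈ K, p₁ + k ≠ 0
  p₂_add_ne_zero : ∀ k ∈ K, p₂ + k ≠ 0
  p₁_add_rot_ne_zero : ∀ j ∈ J N, ∀ l ∈ (lam j).contour, p₁ + ω ^ j * l ≠ 0
  p₂_add_rot_ne_zero : ∀ j ∈ J N, ∀ l ∈ (lam j).contour, p₂ + ω ^ j * l ≠ 0
  kernel_defined : ∀ k ∈ K, ∀ j ∈ J N,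
    ∀ᵐ l ∂((lam j).base.restrict (lam j).contour), k - ω ^ j * l ≠ 0

/-- `φ` solves, for the given `n, m, r`, the linear integral equation at every point `k` of the
spectral domain `K`; the integrals in it are required to converge absolutely. -/
def SolvesIntegralEq (N α β : ℕ) (ω p₁ p₂ : ℂ) (lam : ℕ → SpectralMeasure) (K : Set ℂ)
    (n m r : ℤ) (φ : ℂ → ℂ) : Prop :=
  ∀ k ∈ K,
    (∀ j ∈ J N, (lam j).Converges fun l =>
      rho α β p₁ p₂ n m r k * sigma α β p₁ p₂ n m r (ω ^ j * l) / (k - ω ^ j * l) * φ l) ∧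
    φ k + ∑ j ∈ J N, (lam j).integral (fun l =>
      rho α β p₁ p₂ n m r k * sigma α β p₁ p₂ n m r (ω ^ j * l) / (k - ω ^ j * l) * φ l)
      = rho α β p₁ p₂ n m r k

/-- The integrand of the additive potential `u`. -/
noncomputable def uIntegrand (α β : ℕ) (ω p₁ p₂ : ℂ) (φ : ℤ → ℤ → ℤ → ℂ → ℂ)
    (n m r : ℤ) (j : ℕ) (k : ℂ) : ℂ :=
  φ n m r k * sigma α β p₁ p₂ n m r (ω ^ j * k)

/-- The integrand of the quotient potential `v`. -/
noncomputable def vIntegrand (α β : ℕ) (ω p₁ p₂ : ℂ) (φ : ℤ → ℤ → ℤ → ℂ → ℂ)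
    (n m r : ℤ) (j : ℕ) (k : ℂ) : ℂ :=
  φ n m r k * sigma α β p₁ p₂ n m r (ω ^ j * k) * (ω ^ j)⁻¹ * k⁻¹

/-- The additive potential `u`. -/
noncomputable def u (N α β : ℕ) (ω p₁ p₂ : ℂ) (lam : ℕ → SpectralMeasure)
    (φ : ℤ → ℤ → ℤ → ℂ → ℂ) (n m r : ℤ) : ℂ :=
  ∑ j ∈ J N, (lam j).integral (uIntegrand α β ω p₁ p₂ φ n m r j)

/-- The quotient potential `v`. -/
noncomputable def v (N α β : ℕ) (ω p₁ p₂ : ℂ) (lam : ℕ → SpectralMeasure)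
    (φ : ℤ → ℤ → ℤ → ℂ → ℂ) (n m r : ℤ) : ℂ :=
  1 + ∑ j ∈ J N, (lam j).integral (vIntegrand α β ω p₁ p₂ φ n m r j)

/-- The `N`-periodic Fordy–Xenitidis system for the additive potential, on the lattice `ℤ × ℤ`;
the argument order is `U n m r`. The denominators are required not to vanish. -/
def SolvesAdditiveFX (N α β : ℕ) (p₁ p₂ : ℂ) (U : ℤ → ℤ → ℤ → ℂ) : Prop :=
  (∀ n m r : ℤ, U n m (r + N) = U n m r) ∧
  ∀ n m r : ℤ,
    p₁ + U n m (r + 1 + α + β) - U (n + 1) m (r + β) ≠ 0 ∧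
    p₂ + U n m (r + 1 + α + β) - U n (m + 1) (r + α) ≠ 0 ∧
    (p₁ + U n (m + 1) (r + 1 + α) - U (n + 1) (m + 1) r) /
        (p₁ + U n m (r + 1 + α + β) - U (n + 1) m (r + β)) =
      (p₂ + U (n + 1) m (r + 1 + β) - U (n + 1) (m + 1) r) /
        (p₂ + U n m (r + 1 + α + β) - U n (m + 1) (r + α))

/-- The `N`-periodic Fordy–Xenitidis system for the quotient potential, on the lattice `ℤ × ℤ`;
the argument order is `V n m r`. The denominators are required not to vanish. -/
def SolvesQuotientFX (N α β : ℕ) (p₁ p₂ : ℂ) (V : ℤ → ℤ → ℤ → ℂ) : Prop :=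
  (∀ n m r : ℤ, V n m (r + N) = V n m r) ∧
  (∀ n m r : ℤ, V n m r ≠ 0) ∧
  ∀ n m r : ℤ,
    p₁ * (V (n + 1) (m + 1) r / V n (m + 1) (r + α) -
        V (n + 1) m (r + 1 + β) / V n m (r + 1 + α + β)) =
      p₂ * (V (n + 1) (m + 1) r / V (n + 1) m (r + β) -
        V n (m + 1) (r + 1 + α) / V n m (r + 1 + α + β))

/-- The `ℤ_N`-graded Lax pair with potential `U`, at every spectral parameter `k ∈ K`. The grading
is closed by the quasi-periodicity `φ^{(r+N)}(k) = k^N φ^{(r)}(k)`. -/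
def SolvesLaxPair (N α β : ℕ) (p₁ p₂ : ℂ) (K : Set ℂ) (U : ℤ → ℤ → ℤ → ℂ)
    (φ : ℤ → ℤ → ℤ → ℂ → ℂ) : Prop :=
  ∀ k ∈ K, ∀ n m r : ℤ,
    φ (n + 1) m r k =
      (p₁ + U n m (r + 1 + α) - U (n + 1) m r) * φ n m (r + α) k + φ n m (r + 1 + α) k ∧
    φ n (m + 1) r k =
      (p₂ + U n m (r + 1 + β) - U n (m + 1) r) * φ n m (r + β) k + φ n m (r + 1 + β) k ∧
    φ n m (r + N) k = k ^ N * φ n m r k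

end FordyXenitidis

/-! The argument is direct linearization. A lattice step turns the plane waves `R`, `S` into `(p +
k) R`, `S / (p + k')`. As `(p + k) / (k - k') - 1 = (p + k') / (k - k')`, a shifted solution solves
the unshifted equation with a new right-hand side `R (p + k - u')` (`SolvesWith.remove_factor`); `r
→ r + 1` is the case `p = 0`. Linearity and uniqueness then give the Lax pair (`darboux_eqOn`).
Integrating a Lax equation against `S / k'` yields a Miura relation `p + u₁ - u' = p v' / v`
(`miura_of_darboux`). Both lattice systems are algebraic consequences of these relations, without
any compatibility argument. Division by `v` is legitimate: if `v = 0`, then `φ` at level `r` solves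
the homogeneous equation at level `r + 1` (`SolvesWith.insert_factor`), so it vanishes and `v = 1`.
-/

namespace FordyXenitidis

open MeasureTheory

/-! ### Linearity of the summed contour integrals. -/

section Totals

variable {N : ℕ} {lam : ℕ → SpectralMeasure} {F G : ℕ → ℂ → ℂ}

/-- The sum over `j ∈ J` of the integrals of `F j` against `dλ_j`. -/
noncomputable def total (N : ℕ) (lam : ℕ → SpectralMeasure) (F : ℕ → ℂ → ℂ) : ℂ :=
  ∑ j ∈ J N, (lam j).integral (F j)

/-- All the integrals in `total N lam F` converge absolutely. -/
def TotalConverges (N : ℕ) (lam : ℕ → SpectralMeasure) (F : ℕ → ℂ → ℂ) : Prop :=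
  ∀ j ∈ J N, (lam j).Converges (F j)

/-- `F` and `G` agree almost everywhere on all the contours. -/
def AgreeAE (N : ℕ) (lam : ℕ → SpectralMeasure) (F G : ℕ → ℂ → ℂ) : Prop :=
  ∀ j ∈ J N, ∀ᵐ l ∂((lam j).base.restrict (lam j).contour), F j l = G j l

lemma AgreeAE.of_forall (h : ∀ j ∈ J N, ∀ l ∈ (lam j).contour, F j l = G j l) :
    AgreeAE N lam F G := fun j hj => by
  filter_upwards [ae_restrict_mem (lam j).measurableSet_contour] with l hl using h j hj l hl

lemma AgreeAE.total_eq (h : AgreeAE N lam F G) : total N lam F = total N lam G :=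
  Finset.sum_congr rfl fun j hj => integral_congr_ae <| by
    filter_upwards [h j hj] with l hl
    simp only [hl]

lemma TotalConverges.congr (hF : TotalConverges N lam F) (h : AgreeAE N lam F G) :
    TotalConverges N lam G := fun j hj => (hF j hj).congr <| by
  filter_upwards [h j hj] with l hl
  simp only [hl]

lemma TotalConverges.add (hF : TotalConverges N lam F) (hG : TotalConverges N lam G) :
    TotalConverges N lam (fun j l => F j l + G j l) := fun j hj => by
  have := Integrable.add (hF j hj) (hG j hj)
  refine this.congr (Filter.Eventually.of_forall fun l => ?_)
  simp [add_mul]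

lemma TotalConverges.const_mul (c : ℂ) (hF : TotalConverges N lam F) :
    TotalConverges N lam (fun j l => c * F j l) := fun j hj => by
  refine (Integrable.const_mul (hF j hj) c).congr (Filter.Eventually.of_forall fun l => ?_)
  simp [mul_assoc]

lemma total_add (hF : TotalConverges N lam F) (hG : TotalConverges N lam G) :
    total N lam (fun j l => F j l + G j l) = total N lam F + total N lam G := by
  unfold total
  rw [← Finset.sum_add_distrib]
  refine Finset.sum_congr rfl fun j hj => ?_
  unfold SpectralMeasure.integral
  rw [← integral_add (hF j hj) (hG j hj)]
  simp only [add_mul]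

lemma total_const_mul (c : ℂ) (F : ℕ → ℂ → ℂ) :
    total N lam (fun j l => c * F j l) = c * total N lam F := by
  unfold total SpectralMeasure.integral
  rw [Finset.mul_sum]
  refine Finset.sum_congr rfl fun j _ => ?_
  rw [← integral_const_mul]
  simp only [mul_assoc]

end Totals

/-! ### Dressing of the integral equation. -/

section Equation

variable {N : ℕ} {ω p₁ p₂ : ℂ} {lam : ℕ → SpectralMeasure} {K : Set ℂ}

/-- `ψ` solves on `K` the equation with kernel `R k * S j l / (k - ω ^ j * l)` and inhomogeneous
term `g`. -/
def SolvesWith (N : ℕ) (ω : ℂ) (lam : ℕ → SpectralMeasure) (K : Set ℂ)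
    (R : ℂ → ℂ) (S : ℕ → ℂ → ℂ) (g ψ : ℂ → ℂ) : Prop :=
  ∀ k ∈ K, TotalConverges N lam (fun j l => S j l / (k - ω ^ j * l) * ψ l) ∧
    ψ k + R k * total N lam (fun j l => S j l / (k - ω ^ j * l) * ψ l) = g k

/-- With the kernel fixed, the equation is linear in the pair `(g, ψ)`; this is why `g` is
independent of `R`. -/
lemma SolvesWith.add {R : ℂ → ℂ} {S : ℕ → ℂ → ℂ} {g h ψ χ : ℂ → ℂ}
    (hψ : SolvesWith N ω lam K R S g ψ) (hχ : SolvesWith N ω lam K R S h χ) :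
    SolvesWith N ω lam K R S (fun k => g k + h k) (fun k => ψ k + χ k) := fun k hk => by
  obtain ⟨c₁, e₁⟩ := hψ k hk
  obtain ⟨c₂, e₂⟩ := hχ k hk
  simp only [mul_add]
  refine ⟨c₁.add c₂, ?_⟩
  rw [total_add c₁ c₂, ← e₁, ← e₂]
  ring

lemma SolvesWith.const_mul {R : ℂ → ℂ} {S : ℕ → ℂ → ℂ} {g ψ : ℂ → ℂ} (c : ℂ)
    (hψ : SolvesWith N ω lam K R S g ψ) :
    SolvesWith N ω lam K R S (fun k => c * g k) (fun k => c * ψ k) := fun k hk => by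
  obtain ⟨c₁, e₁⟩ := hψ k hk
  simp only [mul_left_comm _ c]
  refine ⟨c₁.const_mul c, ?_⟩
  rw [total_const_mul, ← e₁]
  ring

lemma SolvesWith.congr_right {R : ℂ → ℂ} {S : ℕ → ℂ → ℂ} {g h ψ : ℂ → ℂ}
    (hψ : SolvesWith N ω lam K R S g ψ) (hgh : ∀ k ∈ K, g k = h k) :
    SolvesWith N ω lam K R S h ψ := fun k hk => by
  rw [← hgh k hk]
  exact hψ k hk

/-- `rho` does not vanish on `K`, so taking it out of the integrals does not affect convergence. -/
lemma solvesIntegralEq_iff {α β : ℕ} (hK : Nondegenerate N ω p₁ p₂ lam K) {n m r : ℤ}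
    {ψ : ℂ → ℂ} :
    SolvesIntegralEq N α β ω p₁ p₂ lam K n m r ψ ↔
      SolvesWith N ω lam K (rho α β p₁ p₂ n m r)
        (fun j l => sigma α β p₁ p₂ n m r (ω ^ j * l)) (rho α β p₁ p₂ n m r) ψ := by
  refine forall₂_congr fun k hk => ?_
  have hρ : rho α β p₁ p₂ n m r k ≠ 0 := by
    have h₀ := hK.ne_zero k hk
    have h₁ := hK.p₁_add_ne_zero k hk
    have h₂ := hK.p₂_add_ne_zero k hk
    unfold rho
    positivity
  simp only [mul_div_assoc, mul_assoc]
  refine and_congr ⟨fun h => ?_, fun h => TotalConverges.const_mul _ h⟩ ?_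
  · have := TotalConverges.const_mul (rho α β p₁ p₂ n m r k)⁻¹ h
    simpa only [inv_mul_cancel_left₀ hρ] using this
  · rw [← total_const_mul]
    rfl

/-- Passing from the plane waves `(p + k) * R`, `S / (p + k')` to `R`, `S`. -/
lemma SolvesWith.remove_factor (hK : Nondegenerate N ω p₁ p₂ lam K) (p : ℂ)
    {R R' ψ : ℂ → ℂ} {S S' : ℕ → ℂ → ℂ}
    (hR : ∀ k ∈ K, R' k = (p + k) * R k)
    (hS : ∀ j ∈ J N, ∀ l ∈ (lam j).contour, S j l = (p + ω ^ j * l) * S' j l)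
    (hψ : SolvesWith N ω lam K R' S' R' ψ)
    (hconv : TotalConverges N lam (fun j l => ψ l * S' j l)) :
    SolvesWith N ω lam K R S
      (fun k => R k * (p + k - total N lam (fun j l => ψ l * S' j l))) ψ := fun k hk => by
  obtain ⟨c, e⟩ := hψ k hk
  -- With `k' = ω ^ j * l`: `(p + k) S' / (k - k') - S' = (p + k') S' / (k - k')`.
  have hagree : AgreeAE N lam
      (fun j l => (p + k) * (S' j l / (k - ω ^ j * l) * ψ l) + -1 * (ψ l * S' j l))
      (fun j l => S j l / (k - ω ^ j * l) * ψ l) := fun j hj => by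
    filter_upwards [hK.kernel_defined k hk j hj,
      ae_restrict_mem (lam j).measurableSet_contour] with l h0 hl
    rw [hS j hj l hl]
    field_simp
    ring
  have c₁ := c.const_mul (p + k)
  have c₂ := hconv.const_mul (-1)
  refine ⟨(c₁.add c₂).congr hagree, ?_⟩
  rw [← hagree.total_eq, total_add c₁ c₂, total_const_mul, total_const_mul]
  rw [hR k hk] at e
  linear_combination e

/-- Passing from the plane waves `R`, `S` to `k * R`, `S / k'`. -/
lemma SolvesWith.insert_factor (hK : Nondegenerate N ω p₁ p₂ lam K)
    {R R' ψ : ℂ → ℂ} {S S' : ℕ → ℂ → ℂ}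
    (hR : ∀ k ∈ K, R' k = k * R k)
    (hS : ∀ j ∈ J N, ∀ l ∈ (lam j).contour, S j l = ω ^ j * l * S' j l)
    (hψ : SolvesWith N ω lam K R S R ψ)
    (hconv : TotalConverges N lam (fun j l => ψ l * S' j l)) :
    SolvesWith N ω lam K R' S'
      (fun k => R k * (1 + total N lam (fun j l => ψ l * S' j l))) ψ := fun k hk => by
  obtain ⟨c, e⟩ := hψ k hk
  have hk0 := hK.ne_zero k hk
  -- With `k' = ω ^ j * l`: `k' / (k - k') + 1 = k / (k - k')`.
  have hagree : AgreeAE N lam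
      (fun j l => k⁻¹ * (S j l / (k - ω ^ j * l) * ψ l) + k⁻¹ * (ψ l * S' j l))
      (fun j l => S' j l / (k - ω ^ j * l) * ψ l) := fun j hj => by
    filter_upwards [hK.kernel_defined k hk j hj,
      ae_restrict_mem (lam j).measurableSet_contour] with l h0 hl
    rw [hS j hj l hl]
    field_simp
    ring
  have c₁ := c.const_mul k⁻¹
  have c₂ := hconv.const_mul k⁻¹
  refine ⟨(c₁.add c₂).congr hagree, ?_⟩
  rw [← hagree.total_eq, total_add c₁ c₂, total_const_mul, total_const_mul, hR k hk]
  linear_combination e + R k * (total N lam (fun j l => S j l / (k - ω ^ j * l) * ψ l) +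
    total N lam (fun j l => ψ l * S' j l)) * mul_inv_cancel₀ hk0

/-- One step of the Lax pair for a lattice shift with parameter `p`. -/
lemma darboux_eqOn (hK : Nondegenerate N ω p₁ p₂ lam K) (p : ℂ)
    {R R₁ R' φ φ₁ φ' : ℂ → ℂ} {S S₁ S' : ℕ → ℂ → ℂ}
    (huniq : ∀ ψ χ, SolvesWith N ω lam K R S R ψ → SolvesWith N ω lam K R S R χ → Set.EqOn ψ χ K)
    (hR₁ : ∀ k ∈ K, R₁ k = k * R k) (hR' : ∀ k ∈ K, R' k = (p + k) * R k)
    (hS₁ : ∀ j ∈ J N, ∀ l ∈ (lam j).contour, S j l = ω ^ j * l * S₁ j l)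
    (hS' : ∀ j ∈ J N, ∀ l ∈ (lam j).contour, S j l = (p + ω ^ j * l) * S' j l)
    (hφ : SolvesWith N ω lam K R S R φ) (hφ₁ : SolvesWith N ω lam K R₁ S₁ R₁ φ₁)
    (hφ' : SolvesWith N ω lam K R' S' R' φ')
    (hc₁ : TotalConverges N lam (fun j l => φ₁ l * S₁ j l))
    (hc' : TotalConverges N lam (fun j l => φ' l * S' j l)) {k : ℂ} (hk : k ∈ K) :
    φ' k = (p + total N lam (fun j l => φ₁ l * S₁ j l) - total N lam (fun j l => φ' l * S' j l))
      * φ k + φ₁ k := by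
  have h' := hφ'.remove_factor hK p hR' hS' hc'
  have h₁ := hφ₁.remove_factor hK 0 (by simpa using hR₁) (by simpa using hS₁) hc₁
  set u₁ := total N lam (fun j l => φ₁ l * S₁ j l)
  set u' := total N lam (fun j l => φ' l * S' j l)
  -- Uniqueness is available only for the right-hand side `R`, so one extra copy of `φ` is added to
  -- the combination that solves the homogeneous equation.
  have h := (h'.add (h₁.const_mul (-1))).add (hφ.const_mul (1 - (p + u₁ - u')))
  have := huniq _ _ (h.congr_right fun k _ => by ring) hφ hk
  linear_combination this

end Equation

/-! ### Shifts of the plane wave factors. -/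

section PlaneWaves

variable {α β : ℕ} {p₁ p₂ k : ℂ}

lemma rho_r_add (hk : k ≠ 0) (n m r s : ℤ) :
    rho α β p₁ p₂ n m (r + s) k = k ^ s * rho α β p₁ p₂ n m r k := by
  unfold rho
  rw [zpow_add₀ hk]
  ring

lemma sigma_r_add (hk : k ≠ 0) (n m r s : ℤ) :
    sigma α β p₁ p₂ n m r k = k ^ s * sigma α β p₁ p₂ n m (r + s) k := by
  unfold sigma
  rw [neg_add, zpow_add₀ hk, zpow_neg k s]
  field_simp

lemma rho_n_add_one (hk : k ≠ 0) (h₁ : p₁ + k ≠ 0) (n m r : ℤ) :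
    rho α β p₁ p₂ (n + 1) m r k = (p₁ + k) * rho α β p₁ p₂ n m (r + α) k := by
  rw [rho_r_add hk]
  unfold rho
  rw [zpow_add_one₀ (by positivity), zpow_natCast]
  ring

lemma sigma_n_add_one (hk : k ≠ 0) (h₁ : p₁ + k ≠ 0) (n m r : ℤ) :
    sigma α β p₁ p₂ n m (r + α) k = (p₁ + k) * sigma α β p₁ p₂ (n + 1) m r k := by
  have h := sigma_r_add (α := α) (β := β) (p₁ := p₁) (p₂ := p₂) hk n m r α
  have h' : sigma α β p₁ p₂ n m r k = k ^ α * (p₁ + k) * sigma α β p₁ p₂ (n + 1) m r k := by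
    unfold sigma
    rw [neg_add, zpow_add₀ (by positivity), zpow_neg_one]
    field_simp
  rw [h', zpow_natCast, mul_assoc] at h
  exact (mul_left_cancel₀ (pow_ne_zero α hk) h).symm

/-- Transfers shifts in `n` to shifts in `m`. -/
lemma rho_swap (n m r : ℤ) : rho α β p₁ p₂ n m r k = rho β α p₂ p₁ m n r k := by
  unfold rho
  ring

lemma sigma_swap (n m r : ℤ) : sigma α β p₁ p₂ n m r k = sigma β α p₂ p₁ m n r k := by
  unfold sigma
  ring

lemma rho_m_add_one (hk : k ≠ 0) (h₂ : p₂ + k ≠ 0) (n m r : ℤ) :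
    rho α β p₁ p₂ n (m + 1) r k = (p₂ + k) * rho α β p₁ p₂ n m (r + β) k := by
  rw [rho_swap, rho_n_add_one hk h₂, rho_swap]

lemma sigma_m_add_one (hk : k ≠ 0) (h₂ : p₂ + k ≠ 0) (n m r : ℤ) :
    sigma α β p₁ p₂ n m (r + β) k = (p₂ + k) * sigma α β p₁ p₂ n (m + 1) r k := by
  rw [sigma_swap, sigma_n_add_one hk h₂, sigma_swap]

end PlaneWaves

/-- The Miura relation for a lattice shift with parameter `p`. -/
lemma miura_of_darboux {N : ℕ} {ω : ℂ} {lam : ℕ → SpectralMeasure} (hω : ω ≠ 0)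
    (hl0 : ∀ j ∈ J N, ∀ l ∈ (lam j).contour, l ≠ 0) {p c : ℂ}
    {φ φ₁ φ' : ℂ → ℂ} {S S₁ S' : ℕ → ℂ → ℂ}
    (hS₁ : ∀ j ∈ J N, ∀ l ∈ (lam j).contour, S j l = ω ^ j * l * S₁ j l)
    (hS' : ∀ j ∈ J N, ∀ l ∈ (lam j).contour, S j l = (p + ω ^ j * l) * S' j l)
    (hc₁ : TotalConverges N lam (fun j l => φ₁ l * S₁ j l))
    (hc' : TotalConverges N lam (fun j l => φ' l * S' j l))
    (hv : TotalConverges N lam (fun j l => φ l * S j l * (ω ^ j)⁻¹ * l⁻¹))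
    (hc : c = p + total N lam (fun j l => φ₁ l * S₁ j l) - total N lam (fun j l => φ' l * S' j l))
    (hlax : ∀ j ∈ J N, ∀ l ∈ (lam j).contour, φ' l = c * φ l + φ₁ l) :
    p * (1 + total N lam (fun j l => φ' l * S' j l * (ω ^ j)⁻¹ * l⁻¹)) =
      c * (1 + total N lam (fun j l => φ l * S j l * (ω ^ j)⁻¹ * l⁻¹)) := by
  -- The Lax relation times `S / k'`, where `S / k' = p S' / k' + S'` and `S₁ = S / k'`.
  have hagree : AgreeAE N lam (fun j l => p * (φ' l * S' j l * (ω ^ j)⁻¹ * l⁻¹))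
      (fun j l => (c * (φ l * S j l * (ω ^ j)⁻¹ * l⁻¹) + φ₁ l * S₁ j l) + -1 * (φ' l * S' j l)) :=
    AgreeAE.of_forall fun j hj l hl => by
      have h0 := hl0 j hj l hl
      have hωj := pow_ne_zero j hω
      have e₁ : φ₁ l * S₁ j l = φ₁ l * S j l * (ω ^ j)⁻¹ * l⁻¹ := by
        rw [hS₁ j hj l hl]
        field_simp
      have e₂ : c * (φ l * S j l * (ω ^ j)⁻¹ * l⁻¹) + φ₁ l * S j l * (ω ^ j)⁻¹ * l⁻¹ =
          φ' l * S j l * (ω ^ j)⁻¹ * l⁻¹ := by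
        rw [hlax j hj l hl]
        ring
      rw [e₁, e₂, hS' j hj l hl]
      field_simp
      ring
  have ht := hagree.total_eq
  rw [total_const_mul, total_add ((hv.const_mul c).add hc₁) (hc'.const_mul _),
    total_add (hv.const_mul c) hc₁, total_const_mul, total_const_mul] at ht
  rw [mul_add, ht]
  linear_combination -hc

end FordyXenitidis

/-! ### Lax pair, Miura relations and lattice systems. -/

open FordyXenitidis in
theorem theorem1 (N : ℕ) (hN : 2 ≤ N) (α β : ℕ) (hα : α < N) (hβ : β < N)
    (ω : ℂ) (hω : IsPrimitiveRoot ω N)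
    (p₁ p₂ : ℂ) (hp₁ : p₁ ≠ 0) (hp₂ : p₂ ≠ 0)
    (lam : ℕ → FordyXenitidis.SpectralMeasure) (K : Set ℂ)
    (hK : FordyXenitidis.Nondegenerate N ω p₁ p₂ lam K)
    (huniq : ∀ n m r : ℤ, ∀ ψ χ : ℂ → ℂ,
      FordyXenitidis.SolvesIntegralEq N α β ω p₁ p₂ lam K n m r ψ →
      FordyXenitidis.SolvesIntegralEq N α β ω p₁ p₂ lam K n m r χ → Set.EqOn ψ χ K)
    (φ : ℤ → ℤ → ℤ → ℂ → ℂ)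
    (hφ : ∀ n m r : ℤ,
      FordyXenitidis.SolvesIntegralEq N α β ω p₁ p₂ lam K n m r (φ n m r))
    (hu : ∀ n m r : ℤ, ∀ j ∈ FordyXenitidis.J N,
      (lam j).Converges (FordyXenitidis.uIntegrand α β ω p₁ p₂ φ n m r j))
    (hv : ∀ n m r : ℤ, ∀ j ∈ FordyXenitidis.J N,
      (lam j).Converges (FordyXenitidis.vIntegrand α β ω p₁ p₂ φ n m r j)) :
    FordyXenitidis.SolvesAdditiveFX N α β p₁ p₂
      (FordyXenitidis.u N α β ω p₁ p₂ lam φ) ∧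
    FordyXenitidis.SolvesQuotientFX N α β p₁ p₂
      (FordyXenitidis.v N α β ω p₁ p₂ lam φ) ∧
    FordyXenitidis.SolvesLaxPair N α β p₁ p₂ K
      (FordyXenitidis.u N α β ω p₁ p₂ lam φ) φ := by
  have hω0 : ω ≠ 0 := hω.ne_zero (by omega)
  have hl0 : ∀ j ∈ J N, ∀ l ∈ (lam j).contour, l ≠ 0 := fun j hj l hl =>
    hK.ne_zero l (hK.contour_subset j hj hl)
  have hx0 : ∀ j ∈ J N, ∀ l ∈ (lam j).contour, ω ^ j * l ≠ 0 := fun j hj l hl =>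
    mul_ne_zero (pow_ne_zero j hω0) (hl0 j hj l hl)
  simp only [solvesIntegralEq_iff hK] at huniq hφ
  have hu' : ∀ n m r, TotalConverges N lam
      (fun j l => φ n m r l * sigma α β p₁ p₂ n m r (ω ^ j * l)) := hu
  have hv' : ∀ n m r, TotalConverges N lam
      (fun j l => φ n m r l * sigma α β p₁ p₂ n m r (ω ^ j * l) * (ω ^ j)⁻¹ * l⁻¹) := hv
  have hR₁ : ∀ n m r, ∀ k ∈ K, rho α β p₁ p₂ n m (r + 1) k = k * rho α β p₁ p₂ n m r k :=
    fun n m r k hk => by simpa using rho_r_add (hK.ne_zero k hk) n m r 1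
  have hS₁ : ∀ n m r, ∀ j ∈ J N, ∀ l ∈ (lam j).contour,
      sigma α β p₁ p₂ n m r (ω ^ j * l) =
        ω ^ j * l * sigma α β p₁ p₂ n m (r + 1) (ω ^ j * l) :=
    fun n m r j hj l hl => by simpa using sigma_r_add (hx0 j hj l hl) n m r 1
  have lax₁ : ∀ n m r, ∀ k ∈ K, φ (n + 1) m r k =
      (p₁ + u N α β ω p₁ p₂ lam φ n m (r + α + 1) - u N α β ω p₁ p₂ lam φ (n + 1) m r) *
        φ n m (r + α) k + φ n m (r + α + 1) k := fun n m r k hk =>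
    darboux_eqOn hK p₁ (huniq n m (r + α)) (hR₁ _ _ _)
      (fun k hk => rho_n_add_one (hK.ne_zero k hk) (hK.p₁_add_ne_zero k hk) n m r)
      (hS₁ _ _ _)
      (fun j hj l hl => sigma_n_add_one (hx0 j hj l hl) (hK.p₁_add_rot_ne_zero j hj l hl) n m r)
      (hφ _ _ _) (hφ _ _ _) (hφ _ _ _) (hu' _ _ _) (hu' _ _ _) hk
  have lax₂ : ∀ n m r, ∀ k ∈ K, φ n (m + 1) r k =
      (p₂ + u N α β ω p₁ p₂ lam φ n m (r + β + 1) - u N α β ω p₁ p₂ lam φ n (m + 1) r) *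
        φ n m (r + β) k + φ n m (r + β + 1) k := fun n m r k hk =>
    darboux_eqOn hK p₂ (huniq n m (r + β)) (hR₁ _ _ _)
      (fun k hk => rho_m_add_one (hK.ne_zero k hk) (hK.p₂_add_ne_zero k hk) n m r)
      (hS₁ _ _ _)
      (fun j hj l hl => sigma_m_add_one (hx0 j hj l hl) (hK.p₂_add_rot_ne_zero j hj l hl) n m r)
      (hφ _ _ _) (hφ _ _ _) (hφ _ _ _) (hu' _ _ _) (hu' _ _ _) hk
  have miura₁ : ∀ n m r, p₁ * v N α β ω p₁ p₂ lam φ (n + 1) m r =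
      (p₁ + u N α β ω p₁ p₂ lam φ n m (r + α + 1) - u N α β ω p₁ p₂ lam φ (n + 1) m r) *
        v N α β ω p₁ p₂ lam φ n m (r + α) := fun n m r =>
    miura_of_darboux hω0 hl0 (hS₁ _ _ _)
      (fun j hj l hl => sigma_n_add_one (hx0 j hj l hl) (hK.p₁_add_rot_ne_zero j hj l hl) n m r)
      (hu' _ _ _) (hu' _ _ _) (hv' _ _ _) rfl
      (fun j hj l hl => lax₁ n m r l (hK.contour_subset j hj hl))
  have miura₂ : ∀ n m r, p₂ * v N α β ω p₁ p₂ lam φ n (m + 1) r =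
      (p₂ + u N α β ω p₁ p₂ lam φ n m (r + β + 1) - u N α β ω p₁ p₂ lam φ n (m + 1) r) *
        v N α β ω p₁ p₂ lam φ n m (r + β) := fun n m r =>
    miura_of_darboux hω0 hl0 (hS₁ _ _ _)
      (fun j hj l hl => sigma_m_add_one (hx0 j hj l hl) (hK.p₂_add_rot_ne_zero j hj l hl) n m r)
      (hu' _ _ _) (hu' _ _ _) (hv' _ _ _) rfl
      (fun j hj l hl => lax₂ n m r l (hK.contour_subset j hj hl))
  -- Since `ω ^ N = 1`, the factor `(ω ^ j * l) ^ N` is `l ^ N`, the same for all `j`; hence `k ^ N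
  -- * φ` solves the equation at level `r + N`.
  have hσN : ∀ n m r, ∀ j ∈ J N, ∀ l ∈ (lam j).contour,
      sigma α β p₁ p₂ n m r (ω ^ j * l) =
        l ^ N * sigma α β p₁ p₂ n m (r + N) (ω ^ j * l) := fun n m r j hj l hl => by
    rw [sigma_r_add (hx0 j hj l hl) n m r N, zpow_natCast, mul_pow, ← pow_mul, mul_comm j,
      pow_mul, hω.pow_eq_one, one_pow, one_mul]
  have hper : ∀ n m r, ∀ k ∈ K, φ n m (r + N) k = k ^ N * φ n m r k := by
    intro n m r
    refine huniq n m (r + N) _ (fun k => k ^ N * φ n m r k) (hφ _ _ _) fun k hk => ?_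
    obtain ⟨c, e⟩ := hφ n m r k hk
    have hagree : AgreeAE N lam
        (fun j l => sigma α β p₁ p₂ n m r (ω ^ j * l) / (k - ω ^ j * l) * φ n m r l)
        (fun j l => sigma α β p₁ p₂ n m (r + N) (ω ^ j * l) / (k - ω ^ j * l) *
          (l ^ N * φ n m r l)) := AgreeAE.of_forall fun j hj l hl => by
      rw [hσN n m r j hj l hl]
      ring
    refine ⟨c.congr hagree, ?_⟩
    rw [← hagree.total_eq, rho_r_add (hK.ne_zero k hk), zpow_natCast]
    linear_combination k ^ N * e
  have hφσ : ∀ n m r, ∀ j ∈ J N, ∀ l ∈ (lam j).contour,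
      φ n m (r + N) l * sigma α β p₁ p₂ n m (r + N) (ω ^ j * l) =
        φ n m r l * sigma α β p₁ p₂ n m r (ω ^ j * l) := fun n m r j hj l hl => by
    rw [hper n m r l (hK.contour_subset j hj hl), hσN n m r j hj l hl]
    ring
  have uper : ∀ n m r, u N α β ω p₁ p₂ lam φ n m (r + N) = u N α β ω p₁ p₂ lam φ n m r :=
    fun n m r => (AgreeAE.of_forall (hφσ n m r)).total_eq
  have vper : ∀ n m r, v N α β ω p₁ p₂ lam φ n m (r + N) = v N α β ω p₁ p₂ lam φ n m r :=
    fun n m r => congrArg (1 + ·) (AgreeAE.of_forall fun j hj l hl => by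
      simp only [vIntegrand, hφσ n m r j hj l hl]).total_eq
  have vne : ∀ n m r, v N α β ω p₁ p₂ lam φ n m r ≠ 0 := by
    intro n m r hv0
    have hagree : AgreeAE N lam (vIntegrand α β ω p₁ p₂ φ n m r)
        (fun j l => φ n m r l * sigma α β p₁ p₂ n m (r + 1) (ω ^ j * l)) :=
      AgreeAE.of_forall fun j hj l hl => by
        have h0 := hl0 j hj l hl
        have hωj := pow_ne_zero j hω0
        rw [vIntegrand, hS₁ n m r j hj l hl]
        field_simp
    have h := (hφ n m r).insert_factor hK (hR₁ n m r) (hS₁ n m r)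
      (TotalConverges.congr (hv' n m r) hagree)
    have hv1 : 1 + total N lam
        (fun j l => φ n m r l * sigma α β p₁ p₂ n m (r + 1) (ω ^ j * l)) = 0 := by
      rw [← hagree.total_eq]
      exact hv0
    -- Adding the homogeneous solution `φ n m r` to `φ n m (r + 1)` gives a second solution at level
    -- `r + 1`.
    have hzero : ∀ k ∈ K, φ n m r k = 0 := fun k hk => by
      have := huniq n m (r + 1) _ _
        (((hφ n m (r + 1)).add h).congr_right fun k _ => by rw [hv1, mul_zero, add_zero])
        (hφ n m (r + 1)) hk
      simpa using this
    have hvan : total N lam (vIntegrand α β ω p₁ p₂ φ n m r) = 0 := by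
      have : AgreeAE N lam (vIntegrand α β ω p₁ p₂ φ n m r) (fun _ _ => 0 * 0) :=
        AgreeAE.of_forall fun j hj l hl => by
          simp [vIntegrand, hzero l (hK.contour_subset j hj hl)]
      rw [this.total_eq, total_const_mul 0 (fun _ _ => 0), zero_mul]
    have hv0' : 1 + total N lam (vIntegrand α β ω p₁ p₂ φ n m r) = 0 := hv0
    simp [hvan] at hv0'
  have ratio₁ : ∀ n m r, p₁ + u N α β ω p₁ p₂ lam φ n m (r + α + 1) -
      u N α β ω p₁ p₂ lam φ (n + 1) m r =
        p₁ * (v N α β ω p₁ p₂ lam φ (n + 1) m r / v N α β ω p₁ p₂ lam φ n m (r + α)) :=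
    fun n m r => by
      rw [← mul_div_assoc, miura₁, mul_div_cancel_right₀ _ (vne _ _ _)]
  have ratio₂ : ∀ n m r, p₂ + u N α β ω p₁ p₂ lam φ n m (r + β + 1) -
      u N α β ω p₁ p₂ lam φ n (m + 1) r =
        p₂ * (v N α β ω p₁ p₂ lam φ n (m + 1) r / v N α β ω p₁ p₂ lam φ n m (r + β)) :=
    fun n m r => by
      rw [← mul_div_assoc, miura₂, mul_div_cancel_right₀ _ (vne _ _ _)]
  refine ⟨⟨uper, fun n m r => ?_⟩, ⟨vper, vne, fun n m r => ?_⟩, fun k hk n m r => ⟨?_, ?_, ?_⟩⟩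
  · have e₁ := ratio₁ n m (r + β)
    have e₂ := ratio₂ n m (r + α)
    have e₃ := ratio₁ n (m + 1) r
    have e₄ := ratio₂ (n + 1) m r
    rw [show r + (β : ℤ) + α + 1 = r + 1 + α + β by ring,
      show r + (β : ℤ) + α = r + α + β by ring] at e₁
    rw [show r + (α : ℤ) + β + 1 = r + 1 + α + β by ring] at e₂
    rw [add_right_comm r (α : ℤ) 1] at e₃
    rw [add_right_comm r (β : ℤ) 1] at e₄
    rw [e₁, e₂, e₃, e₄]
    have a₁ := vne n m (r + α + β)
    have a₂ := vne (n + 1) m (r + β)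
    have a₃ := vne n (m + 1) (r + α)
    refine ⟨mul_ne_zero hp₁ (div_ne_zero a₂ a₁), mul_ne_zero hp₂ (div_ne_zero a₃ a₁), ?_⟩
    -- Both quotients equal `v₁₁ v₀₀ / (v₀₁ v₁₀)`, the subscripts being the shifts in `n` and `m`.
    field_simp
  · have e₁ := ratio₁ n (m + 1) r
    have e₂ := ratio₁ n m (r + 1 + β)
    have e₃ := ratio₂ (n + 1) m r
    have e₄ := ratio₂ n m (r + 1 + α)
    rw [show r + 1 + (β : ℤ) + α = r + 1 + α + β by ring] at e₂
    rw [add_right_comm r (α : ℤ) 1] at e₁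
    rw [add_right_comm r (β : ℤ) 1] at e₃
    -- In this combination all `u` terms, `p₁` and `p₂` on the left-hand sides cancel.
    linear_combination -e₁ + e₂ + e₃ - e₄
  · rw [add_right_comm r 1 (α : ℤ)]
    exact lax₁ n m r k hk
  · rw [add_right_comm r 1 (β : ℤ)]
    exact lax₂ n m r k hk
  · exact hper n m r k hk
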